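/- Let $n\ge 1$ be an integer and let $d\ge 2$ be an even integer. Let $\mathcal F_{d,n}$ be the space of real homogeneous polynomials (forms) of degree $d$ in $n$ variables, including $0$. For $f\in\mathcal F_{d,n}$ let $v(f)\in[0,+\infty]$ denote the Lebesgue volume of the sublevel set $\{x\in\mathbb R^n : f(x)\le 1\}$. Write $$f(x)=\sum_{|\alpha|=d} f_\alpha \sqrt{\binom{d}{\alpha}}\,x^\alpha,\qquad \binom{d}{\alpha}=\frac{d!}{\alpha_1!\cdots\alpha_n!},$$ and define the Bombieri norm of $f$ by $\|f\|_B=\bigl(\sum_{|\alpha|=d} f_\alpha^2\bigr)^{1/2}$. Let $b_{d,n}(x)=(x_1^2+\cdots+x_n^2)^{d/2}$. Then the form $b_{d,n}/\|b_{d,n}\|_B\in\mathcal F_{d,n}$ has Bombieri norm $1$, and for every $f\in\mathcal F_{d,n}$ with $\|f\|_B\le 1$, $$v\!\left(\frac{b_{d,n}}{\|b_{d,n}\|_B}\right)=\left(\prod_{i=0}^{d/2-1}\frac{2i+n}{2i+1}\right)^{\frac{n}{2d}}\frac{\pi^{n/2}}{\Gamma\left(\frac n2+1\right)}\;\le\;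 v(f),$$ with equality $v(f)=v\bigl(b_{d,n}/\|b_{d,n}\|_B\bigr)$ if and only if $f=b_{d,n}/\|b_{d,n}\|_B$. -/

import Mathlib

open MeasureTheory

noncomputable section

namespace BombieriForms

/-- The sublevel set `{f ≤ 1}` of a real polynomial in `n` variables, as a subset of Euclidean
space. -/
def sublevelSet {n : ℕ} (f : MvPolynomial (Fin n) ℝ) : Set (EuclideanSpace ℝ (Fin n)) :=
  {x | MvPolynomial.eval (fun i => x i) f ≤ 1}

/-- `v(f)`: the Lebesgue volume of `{f ≤ 1}`, possibly infinite. -/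
def sublevelVolume {n : ℕ} (f : MvPolynomial (Fin n) ℝ) : ENNReal :=
  volume (sublevelSet f)

/-- The coordinate `f_α` of `f` in the basis of rescaled monomials
`√(|α|! / (α₁! ⋯ αₙ!)) * x ^ α`. -/
def rescaledCoeff {n : ℕ} (f : MvPolynomial (Fin n) ℝ) (α : Fin n →₀ ℕ) : ℝ :=
  MvPolynomial.coeff α f / √(Nat.multinomial Finset.univ α : ℝ)

/-- The Bombieri norm of a form `f` of degree `d`: the square root of the sum of `f_α ^ 2` over all
exponents `α` with `|α| = d`. -/
def bombieriNorm {n : ℕ} (d : ℕ) (f : MvPolynomial (Fin n) ℝ) : ℝ :=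
  √(∑ α ∈ Finset.finsuppAntidiag (Finset.univ : Finset (Fin n)) d, rescaledCoeff f α ^ 2)

/-- `b_{d,n} = (x₁² + ⋯ + xₙ²)^(d/2)`, used for even `d`. -/
def euclideanForm (d n : ℕ) : MvPolynomial (Fin n) ℝ :=
  (∑ i, MvPolynomial.X i ^ 2) ^ (d / 2)

/-- `b_{d,n} / ‖b_{d,n}‖_B`. -/
def normalizedEuclideanForm (d n : ℕ) : MvPolynomial (Fin n) ℝ :=
  (bombieriNorm d (euclideanForm d n))⁻¹ • euclideanForm d n

/-- The number
`(∏_{i=0}^{d/2-1} (2i+n)/(2i+1))^(n/(2d)) * (√π)^n / Γ(n/2+1)`. -/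
def minimalVolume (d n : ℕ) : ℝ :=
  (∏ i ∈ Finset.range (d / 2), (2 * (i : ℝ) + (n : ℝ)) / (2 * (i : ℝ) + 1)) ^
      ((n : ℝ) / (2 * (d : ℝ))) *
    (√Real.pi ^ n / Real.Gamma ((n : ℝ) / 2 + 1))

end BombieriForms

end

/-!
Let `g` be the normalized Euclidean form and suppose `‖f‖_B ≤ 1` and `v(f) ≤ v(g)`. All sublevel
sets of a form are dilates of `{f ≤ 1}`, so `{f ≤ s}` has at most the volume of `{g ≤ s}` for every
`s`, and the layer cake formula gives `∫ (1 - f)⁺ ≤ ∫ (1 - g)⁺`. Hence `∫_B g ≤ ∫_B f` on the ball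
`B = {g ≤ 1}`. In polar coordinates, the integral over `B` and the integral against `exp (-‖x‖²)`
of a form of degree `d` are both positive multiples of its integral over the sphere. By the moments
of the Gaussian, the latter integral is a positive multiple of the Bombieri product with `g`,
so `1 = ⟪g, g⟫_B ≤ ⟪f, g⟫_B`, and the equality case of Cauchy–Schwarz forces `f = g`.
-/

open Set Module

open scoped RealInnerProductSpace

namespace BombieriForms

section Bathtub

variable {α : Type*} [MeasurableSpace α] {μ : Measure α} {F G : α → ℝ} {c : ℝ}

lemma lintegral_ofReal_sub_le_of_measure_sublevel_le (hF : Measurable F) (hG : Measurable G)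
    (h : ∀ s < c, μ {x | F x ≤ s} ≤ μ {x | G x ≤ s}) :
    ∫⁻ x, ENNReal.ofReal (c - F x) ∂μ ≤ ∫⁻ x, ENNReal.ofReal (c - G x) ∂μ := by
  have layercake (H : α → ℝ) (hH : Measurable H) : ∫⁻ x, ENNReal.ofReal (c - H x) ∂μ =
      ∫⁻ t in Ioi (0 : ℝ), μ {x | H x ≤ c - t} := by
    have hmax : ∫⁻ x, ENNReal.ofReal (c - H x) ∂μ = ∫⁻ x, ENNReal.ofReal (max (c - H x) 0) ∂μ := by
      simp only [ENNReal.ofReal_max, ENNReal.ofReal_zero, zero_le, sup_of_le_left]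
    rw [hmax, lintegral_eq_lintegral_meas_le μ (f := fun x ↦ max (c - H x) 0)
      (ae_of_all _ fun x ↦ le_max_right _ _) (by fun_prop)]
    refine setLIntegral_congr_fun measurableSet_Ioi fun t ht ↦ congrArg μ ?_
    ext x
    simp only [mem_ofPred_eq, le_max_iff, not_le.2 (mem_Ioi.1 ht), or_false, le_sub_comm]
  rw [layercake F hF, layercake G hG]
  exact setLIntegral_mono' measurableSet_Ioi fun t ht ↦ h _ (sub_lt_self c ht)

lemma setIntegral_sublevel_le_of_measure_sublevel_le (hF : Measurable F) (hG : Measurable G)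
    (hFi : IntegrableOn F {x | G x ≤ c} μ) (hGi : IntegrableOn G {x | G x ≤ c} μ)
    (hfin : μ {x | G x ≤ c} ≠ ⊤) (h : ∀ s < c, μ {x | F x ≤ s} ≤ μ {x | G x ≤ s}) :
    ∫ x in {x | G x ≤ c}, G x ∂μ ≤ ∫ x in {x | G x ≤ c}, F x ∂μ := by
  have hK : MeasurableSet {x | G x ≤ c} := hG measurableSet_Iic
  have hc : IntegrableOn (fun _ : α ↦ c) {x | G x ≤ c} μ := integrableOn_const hfin
  have hFsub : IntegrableOn (fun x ↦ c - F x) {x | G x ≤ c} μ := hc.sub hFi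
  have hGsub : IntegrableOn (fun x ↦ c - G x) {x | G x ≤ c} μ := hc.sub hGi
  have hG_nonneg : 0 ≤ᵐ[μ.restrict {x | G x ≤ c}] fun x ↦ c - G x :=
    (ae_restrict_iff' hK).2 (ae_of_all _ fun x hx ↦ sub_nonneg.2 hx)
  have hG_eq : ∫⁻ x, ENNReal.ofReal (c - G x) ∂μ =
      ENNReal.ofReal (∫ x in {x | G x ≤ c}, (c - G x) ∂μ) := by
    rw [ofReal_integral_eq_lintegral_ofReal hGsub hG_nonneg,
      setLIntegral_eq_of_support_subset]
    intro x hx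
    simpa using (ENNReal.ofReal_pos.1 (pos_iff_ne_zero.2 hx)).le
  have hF_le : ENNReal.ofReal (∫ x in {x | G x ≤ c}, (c - F x) ∂μ) ≤
      ∫⁻ x, ENNReal.ofReal (c - F x) ∂μ := by
    calc ENNReal.ofReal (∫ x in {x | G x ≤ c}, (c - F x) ∂μ)
        ≤ ∫⁻ x in {x | G x ≤ c}, ENNReal.ofReal (c - F x) ∂μ := by
          rw [integral_eq_lintegral_pos_part_sub_lintegral_neg_part hFsub]
          exact (ENNReal.ofReal_le_ofReal (sub_le_self _ ENNReal.toReal_nonneg)).trans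
            ENNReal.ofReal_toReal_le
      _ ≤ _ := setLIntegral_le_lintegral _ _
  have hsub := (ENNReal.ofReal_le_ofReal_iff (integral_nonneg_of_ae hG_nonneg)).1 <|
    (hF_le.trans (lintegral_ofReal_sub_le_of_measure_sublevel_le hF hG h)).trans_eq hG_eq
  rw [integral_sub hc hFi, integral_sub hc hGi] at hsub
  exact (sub_le_sub_iff_left _).1 hsub

end Bathtub

/-- `F` is positively homogeneous of degree `d`. Only positive dilations are considered, so that
`‖x‖ ^ d` is an example for odd `d` too. -/
def IsPosHomogeneous {E : Type*} [SMul ℝ E] (d : ℕ) (F : E → ℝ) : Prop :=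
  ∀ r : ℝ, 0 < r → ∀ x, F (r • x) = r ^ d * F x

namespace IsPosHomogeneous

open scoped Pointwise

lemma sublevel_eq_smul {E : Type*} [AddCommGroup E] [Module ℝ E] {F : E → ℝ} {d : ℕ} {s : ℝ}
    (hF : IsPosHomogeneous d F) (hd : d ≠ 0) (hs : 0 < s) :
    {x | F x ≤ s} = s ^ (d⁻¹ : ℝ) • {x | F x ≤ 1} := by
  have hr : 0 < s ^ (d⁻¹ : ℝ) := Real.rpow_pos_of_pos hs _
  ext x
  rw [mem_smul_set_iff_inv_smul_mem₀ hr.ne', mem_ofPred_eq, mem_ofPred_eq, hF _ (inv_pos.2 hr),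
    inv_pow, Real.rpow_inv_natCast_pow hs.le hd, inv_mul_le_iff₀ hs, mul_one]

lemma smul_nonpos_eq {E : Type*} [AddCommGroup E] [Module ℝ E] {F : E → ℝ} {d : ℕ} {r : ℝ}
    (hF : IsPosHomogeneous d F) (hr : 0 < r) : r • {x | F x ≤ 0} = {x | F x ≤ 0} := by
  ext x
  rw [mem_smul_set_iff_inv_smul_mem₀ hr.ne', mem_ofPred_eq, mem_ofPred_eq, hF _ (inv_pos.2 hr),
    ← smul_eq_mul, smul_nonpos_iff_nonpos_of_pos_left (pow_pos (inv_pos.2 hr) d)]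

variable {E : Type*} [NormedAddCommGroup E] [NormedSpace ℝ E] [MeasurableSpace E] [BorelSpace E]
  [FiniteDimensional ℝ E] [Nontrivial E] {μ : Measure E} [μ.IsAddHaarMeasure] {F G : E → ℝ} {d : ℕ}

lemma measure_nonpos_eq_zero (hF : IsPosHomogeneous d F) (hfin : μ {x | F x ≤ 0} ≠ ⊤) :
    μ {x | F x ≤ 0} = 0 := by
  have hdilate : μ {x | F x ≤ 0} = ENNReal.ofReal (2 ^ finrank ℝ E) * μ {x | F x ≤ 0} := by
    conv_lhs => rw [← hF.smul_nonpos_eq two_pos, Measure.addHaar_smul, abs_of_pos (by positivity)]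
  by_contra hne
  have hone := (ENNReal.mul_eq_right hne hfin).1 hdilate.symm
  rw [ENNReal.ofReal_eq_one] at hone
  exact (one_lt_pow₀ one_lt_two finrank_pos.ne').ne' hone

lemma measure_sublevel_le (hd : d ≠ 0) (hF : IsPosHomogeneous d F) (hG : IsPosHomogeneous d G)
    (hfin : μ {x | F x ≤ 1} ≠ ⊤) (h : μ {x | F x ≤ 1} ≤ μ {x | G x ≤ 1}) (s : ℝ) :
    μ {x | F x ≤ s} ≤ μ {x | G x ≤ s} := by
  rcases lt_or_ge 0 s with hs | hs
  · rw [hF.sublevel_eq_smul hd hs, hG.sublevel_eq_smul hd hs, Measure.addHaar_smul,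
      Measure.addHaar_smul]
    gcongr
  · have hzero : μ {x | F x ≤ 0} = 0 := hF.measure_nonpos_eq_zero <|
      ne_top_of_le_ne_top hfin (measure_mono fun x (hx : F x ≤ 0) ↦ hx.trans zero_le_one)
    exact (measure_mono_null (fun x hx ↦ le_trans hx hs) hzero).trans_le zero_le

lemma setIntegral_sublevel_le (hd : d ≠ 0) (hF : IsPosHomogeneous d F)
    (hG : IsPosHomogeneous d G) (hFc : Continuous F) (hGc : Continuous G)
    (hK : IsCompact {x | G x ≤ 1}) (h : μ {x | F x ≤ 1} ≤ μ {x | G x ≤ 1}) :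
    ∫ x in {x | G x ≤ 1}, G x ∂μ ≤ ∫ x in {x | G x ≤ 1}, F x ∂μ :=
  setIntegral_sublevel_le_of_measure_sublevel_le hFc.measurable hGc.measurable
    (hFc.continuousOn.integrableOn_compact hK) (hGc.continuousOn.integrableOn_compact hK)
    hK.measure_lt_top.ne
    fun s _ ↦ measure_sublevel_le hd hF hG (ne_top_of_le_ne_top hK.measure_lt_top.ne h) h s

end IsPosHomogeneous

section PolarCoordinates

lemma integral_pow_mul_exp_neg_sq_Ioi (k : ℕ) :
    ∫ t in Ioi (0 : ℝ), t ^ k * Real.exp (-t ^ 2) = 1 / 2 * Real.Gamma ((k + 1) / 2) := by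
  simpa using integral_rpow_mul_exp_neg_rpow (p := 2) (q := k) two_pos
    (neg_one_lt_zero.trans_le k.cast_nonneg)

namespace IsPosHomogeneous

open Metric

variable {E : Type*} [NormedAddCommGroup E] [NormedSpace ℝ E] [MeasurableSpace E] [BorelSpace E]
  [FiniteDimensional ℝ E] [Nontrivial E] {μ : Measure E} [μ.IsAddHaarMeasure] {F G : E → ℝ} {d : ℕ}

lemma integral_mul_radial (hF : IsPosHomogeneous d F) (φ : ℝ → ℝ) :
    ∫ x, F x * φ ‖x‖ ∂μ = (∫ u, F u ∂μ.toSphere) *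
      ∫ r in Ioi (0 : ℝ), r ^ (finrank ℝ E - 1 + d) * φ r := by
  calc
    ∫ x, F x * φ ‖x‖ ∂μ = ∫ x : ({0}ᶜ : Set E), F x * φ ‖x.1‖ ∂(μ.comap (↑)) := by
      rw [integral_subtype_comap (measurableSet_singleton _).compl fun x ↦ F x * φ ‖x‖,
        restrict_compl_singleton]
    _ = ∫ p, F p.1 * ((p.2 : ℝ) ^ d * φ p.2)
          ∂μ.toSphere.prod (.volumeIoiPow (finrank ℝ E - 1)) := by
      rw [← μ.measurePreserving_homeomorphUnitSphereProd.integral_comp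
        (Homeomorph.measurableEmbedding _)]
      refine integral_congr_ae (ae_of_all _ fun x ↦ ?_)
      have hx : 0 < ‖x.1‖ := norm_pos_iff.2 x.2
      simp only [homeomorphUnitSphereProd_apply_snd_coe, homeomorphUnitSphereProd_apply_fst_coe,
        hF _ (inv_pos.2 hx), inv_pow]
      field_simp
    _ = (∫ u, F u ∂μ.toSphere) *
          ∫ r : Ioi (0 : ℝ), (r : ℝ) ^ d * φ r ∂.volumeIoiPow (finrank ℝ E - 1) :=
      integral_prod_mul (fun u : sphere (0 : E) 1 ↦ F u) fun r : Ioi (0 : ℝ) ↦ (r : ℝ) ^ d * φ r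
    _ = _ := by
      congr 1
      simp only [Measure.volumeIoiPow, ENNReal.ofReal]
      rw [integral_withDensity_eq_integral_smul (by fun_prop),
        integral_subtype_comap measurableSet_Ioi
          fun r ↦ Real.toNNReal (r ^ (finrank ℝ E - 1)) • (r ^ d * φ r)]
      refine setIntegral_congr_fun measurableSet_Ioi fun r hr ↦ ?_
      rw [NNReal.smul_def, Real.coe_toNNReal _ (pow_nonneg (le_of_lt hr) _), smul_eq_mul, pow_add,
        mul_assoc]

lemma integral_mul_exp_neg_norm_sq (hF : IsPosHomogeneous d F) :
    ∫ x, F x * Real.exp (-‖x‖ ^ 2) ∂μ =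
      (∫ u, F u ∂μ.toSphere) * (1 / 2 * Real.Gamma ((finrank ℝ E + d) / 2)) := by
  rw [hF.integral_mul_radial fun r ↦ Real.exp (-r ^ 2), integral_pow_mul_exp_neg_sq_Ioi]
  push_cast [Nat.cast_sub (finrank_pos (R := ℝ) (M := E))]
  ring_nf

lemma setIntegral_closedBall (hF : IsPosHomogeneous d F) {R : ℝ} (hR : 0 ≤ R) :
    ∫ x in closedBall 0 R, F x ∂μ =
      (∫ u, F u ∂μ.toSphere) * (R ^ (finrank ℝ E + d) / (finrank ℝ E + d)) := by
  have hradial : ∫ r in Ioi (0 : ℝ), r ^ (finrank ℝ E - 1 + d) * (Iic R).indicator 1 r =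
      R ^ (finrank ℝ E + d) / (finrank ℝ E + d) := by
    have hmul (r : ℝ) : r ^ (finrank ℝ E - 1 + d) * (Iic R).indicator 1 r =
        (Iic R).indicator (fun r ↦ r ^ (finrank ℝ E - 1 + d)) r := by
      simp [indicator]
    have hdim : finrank ℝ E - 1 + d + 1 = finrank ℝ E + d := by
      have := finrank_pos (R := ℝ) (M := E)
      omega
    simp only [hmul]
    rw [setIntegral_indicator measurableSet_Iic, Ioi_inter_Iic,
      ← intervalIntegral.integral_of_le hR, integral_pow, ← Nat.cast_succ, Nat.succ_eq_add_one,
      hdim, zero_pow (Nat.add_pos_left finrank_pos d).ne', sub_zero, Nat.cast_add]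
  rw [← integral_indicator isClosed_closedBall.measurableSet, ← hradial, ← hF.integral_mul_radial]
  refine integral_congr_ae (ae_of_all _ fun x ↦ ?_)
  by_cases hx : ‖x‖ ≤ R <;> simp [indicator, hx]

lemma integral_mul_exp_neg_norm_sq_le (hF : IsPosHomogeneous d F) (hG : IsPosHomogeneous d G)
    {R : ℝ} (hR : 0 < R) (h : ∫ x in closedBall 0 R, F x ∂μ ≤ ∫ x in closedBall 0 R, G x ∂μ) :
    ∫ x, F x * Real.exp (-‖x‖ ^ 2) ∂μ ≤ ∫ x, G x * Real.exp (-‖x‖ ^ 2) ∂μ := by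
  have hdim : 0 < finrank ℝ E := finrank_pos
  rw [hF.setIntegral_closedBall hR.le, hG.setIntegral_closedBall hR.le] at h
  have hsphere := le_of_mul_le_mul_right h (by positivity)
  rw [hF.integral_mul_exp_neg_norm_sq, hG.integral_mul_exp_neg_norm_sq]
  gcongr

end IsPosHomogeneous

end PolarCoordinates

section GaussianMoments

lemma gamma_add_nat {s : ℝ} (hs : 0 < s) (m : ℕ) :
    Real.Gamma (s + m) = Real.Gamma s * ∏ i ∈ Finset.range m, (s + i) := by
  induction m with
  | zero => simp
  | succ m ih =>
    rw [Nat.cast_succ, ← add_assoc, Real.Gamma_add_one (by positivity), ih, Finset.prod_range_succ]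
    ring

lemma prod_range_one_half_add (m : ℕ) :
    ∏ i ∈ Finset.range m, (1 / 2 + i : ℝ) = (2 * m).factorial / (4 ^ m * m.factorial) := by
  induction m with
  | zero => simp
  | succ m ih =>
    rw [Finset.prod_range_succ, ih, show 2 * (m + 1) = 2 * m + 1 + 1 by ring]
    simp only [Nat.factorial_succ]
    push_cast
    field_simp
    ring

lemma integral_pow_mul_exp_neg_sq_of_odd {k : ℕ} (hk : Odd k) :
    ∫ t : ℝ, t ^ k * Real.exp (-t ^ 2) = 0 := by
  have h := integral_neg_eq_self (fun t : ℝ ↦ t ^ k * Real.exp (-t ^ 2)) volume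
  simp only [hk.neg_pow, neg_sq, neg_mul, integral_neg] at h
  linarith

lemma integral_pow_two_mul_mul_exp_neg_sq (j : ℕ) :
    ∫ t : ℝ, t ^ (2 * j) * Real.exp (-t ^ 2) =
      √Real.pi * ((2 * j).factorial / (4 ^ j * j.factorial)) := by
  have habs := integral_comp_abs (f := fun t : ℝ ↦ t ^ (2 * j) * Real.exp (-t ^ 2))
  simp only [(even_two_mul j).pow_abs, sq_abs] at habs
  have harg : (((2 * j : ℕ) : ℝ) + 1) / 2 = 1 / 2 + j := by
    push_cast
    ring
  rw [habs, integral_pow_mul_exp_neg_sq_Ioi, harg, gamma_add_nat one_half_pos,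
    Real.Gamma_one_half_eq, prod_range_one_half_add, ← mul_assoc, mul_one_div_cancel two_ne_zero,
    one_mul]

variable {ι : Type*} [Fintype ι]

lemma exp_neg_norm_sq_eq_prod (x : EuclideanSpace ℝ ι) :
    Real.exp (-‖x‖ ^ 2) = ∏ i, Real.exp (-x i ^ 2) := by
  rw [EuclideanSpace.real_norm_sq_eq, ← Real.exp_sum, Finset.sum_neg_distrib]

lemma integral_prod_pow_mul_exp_neg_norm_sq (α : ι → ℕ) :
    ∫ x : EuclideanSpace ℝ ι, (∏ i, x i ^ α i) * Real.exp (-‖x‖ ^ 2) =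
      ∏ i, ∫ t : ℝ, t ^ α i * Real.exp (-t ^ 2) := by
  simp only [exp_neg_norm_sq_eq_prod, ← Finset.prod_mul_distrib]
  rw [← integral_fintype_prod_volume_eq_prod fun i (t : ℝ) ↦ t ^ α i * Real.exp (-t ^ 2)]
  exact (PiLp.volume_preserving_ofLp ι).integral_comp
    (MeasurableEquiv.toLp 2 (ι → ℝ)).symm.measurableEmbedding
    fun y : ι → ℝ ↦ ∏ i, (y i ^ α i * Real.exp (-y i ^ 2))

lemma integrable_prod_pow_mul_exp_neg_norm_sq (α : ι → ℕ) :
    Integrable fun x : EuclideanSpace ℝ ι ↦ (∏ i, x i ^ α i) * Real.exp (-‖x‖ ^ 2) := by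
  simp only [exp_neg_norm_sq_eq_prod, ← Finset.prod_mul_distrib]
  have hfactor (i : ι) : Integrable fun t : ℝ ↦ t ^ α i * Real.exp (-t ^ 2) := by
    simpa using integrable_rpow_mul_exp_neg_mul_sq one_pos (s := α i)
      (neg_one_lt_zero.trans_le (α i).cast_nonneg)
  exact ((PiLp.volume_preserving_ofLp ι).integrable_comp_emb
    (MeasurableEquiv.toLp 2 (ι → ℝ)).symm.measurableEmbedding).2 (Integrable.fintype_prod hfactor)

lemma integral_norm_pow_mul_exp_neg_norm_sq [Nonempty ι] (k : ℕ) :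
    ∫ x : EuclideanSpace ℝ ι, ‖x‖ ^ k * Real.exp (-‖x‖ ^ 2) =
      √Real.pi ^ Fintype.card ι *
        (Real.Gamma ((Fintype.card ι + k) / 2) / Real.Gamma (Fintype.card ι / 2)) := by
  have hnorm : IsPosHomogeneous k fun x : EuclideanSpace ℝ ι ↦ ‖x‖ ^ k := fun r hr x ↦ by
    simp only [norm_smul_of_nonneg hr.le, mul_pow]
  have hcard : 0 < (Fintype.card ι : ℝ) / 2 := by positivity
  have hsphere : ∫ u : Metric.sphere (0 : EuclideanSpace ℝ ι) 1, ‖u.1‖ ^ k ∂volume.toSphere =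
      Fintype.card ι * (√Real.pi ^ Fintype.card ι / Real.Gamma (Fintype.card ι / 2 + 1)) := by
    simp only [norm_eq_of_mem_sphere, one_pow, integral_const, smul_eq_mul, mul_one,
      Measure.toSphere_real_apply_univ, finrank_euclideanSpace]
    rw [measureReal_def, EuclideanSpace.volume_ball, ENNReal.ofReal_one, one_pow, one_mul,
      ENNReal.toReal_ofReal (by positivity)]
  rw [hnorm.integral_mul_exp_neg_norm_sq, hsphere, finrank_euclideanSpace,
    Real.Gamma_add_one hcard.ne']
  field_simp

end GaussianMoments

section Forms

variable {n : ℕ} {d : ℕ} {f : MvPolynomial (Fin n) ℝ}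

/-- A polynomial as a function on Euclidean space, where balls and spheres are the round ones. -/
noncomputable def evalEuclidean (f : MvPolynomial (Fin n) ℝ) (x : EuclideanSpace ℝ (Fin n)) : ℝ :=
  MvPolynomial.eval (fun i ↦ x i) f

lemma continuous_evalEuclidean (f : MvPolynomial (Fin n) ℝ) : Continuous (evalEuclidean f) :=
  (MvPolynomial.continuous_eval f).comp (PiLp.continuous_ofLp 2 _)

lemma evalEuclidean_eq_sum (hf : f.IsHomogeneous d) (x : EuclideanSpace ℝ (Fin n)) :
    evalEuclidean f x = ∑ α ∈ Finset.finsuppAntidiag Finset.univ d,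
      MvPolynomial.coeff α f * ∏ i, x i ^ α i := by
  rw [evalEuclidean, MvPolynomial.eval_eq']
  refine Finset.sum_subset (fun α hα ↦ ?_) fun α _ hα ↦ ?_
  · rw [Finset.mem_finsuppAntidiag, ← Finsupp.degree_eq_sum]
    refine ⟨?_, Finset.subset_univ _⟩
    by_contra hdeg
    exact MvPolynomial.mem_support_iff.1 hα (hf.coeff_eq_zero hdeg)
  · rw [MvPolynomial.notMem_support_iff.1 hα, zero_mul]

lemma isPosHomogeneous_evalEuclidean (hf : f.IsHomogeneous d) :
    IsPosHomogeneous d (evalEuclidean f) := by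
  intro r _ x
  simp only [evalEuclidean_eq_sum hf, Finset.mul_sum]
  refine Finset.sum_congr rfl fun α hα ↦ ?_
  simp only [PiLp.smul_apply, smul_eq_mul, mul_pow, Finset.prod_mul_distrib,
    Finset.prod_pow_eq_pow_sum, (Finset.mem_finsuppAntidiag.1 hα).1]
  ring

/-- The vector of coordinates of a form of degree `d` in the basis of rescaled monomials. It
identifies the Bombieri norm with a Euclidean norm. -/
noncomputable def coeffVector (d : ℕ) :
    MvPolynomial (Fin n) ℝ →ₗ[ℝ]
      EuclideanSpace ℝ (Finset.finsuppAntidiag (Finset.univ : Finset (Fin n)) d) where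
  toFun f := WithLp.toLp 2 fun α ↦ rescaledCoeff f α
  map_add' f g := by
    ext α
    simp [rescaledCoeff, add_div]
  map_smul' c f := by
    ext α
    simp [rescaledCoeff, mul_div_assoc]

lemma coeffVector_apply (f : MvPolynomial (Fin n) ℝ)
    (α : Finset.finsuppAntidiag (Finset.univ : Finset (Fin n)) d) :
    coeffVector d f α = rescaledCoeff f α :=
  rfl

lemma norm_coeffVector (d : ℕ) (f : MvPolynomial (Fin n) ℝ) :
    ‖coeffVector d f‖ = bombieriNorm d f := by
  simp only [EuclideanSpace.norm_eq, coeffVector_apply, Real.norm_eq_abs, sq_abs, bombieriNorm]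
  rw [Finset.sum_coe_sort _ fun α ↦ rescaledCoeff f α ^ 2]

lemma inner_coeffVector (f g : MvPolynomial (Fin n) ℝ) :
    ⟪coeffVector d f, coeffVector d g⟫ = ∑ α ∈ Finset.finsuppAntidiag Finset.univ d,
      MvPolynomial.coeff α f * (MvPolynomial.coeff α g / Nat.multinomial Finset.univ α) := by
  simp only [PiLp.inner_apply, coeffVector_apply, RCLike.inner_apply, conj_trivial]
  rw [Finset.sum_coe_sort _ fun α ↦ rescaledCoeff g α * rescaledCoeff f α]
  refine Finset.sum_congr rfl fun α _ ↦ ?_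
  rw [rescaledCoeff, rescaledCoeff, div_mul_div_comm, Real.mul_self_sqrt (Nat.cast_nonneg _),
    mul_comm, mul_div_assoc]

lemma injOn_coeffVector (n d : ℕ) :
    InjOn (coeffVector d) {f : MvPolynomial (Fin n) ℝ | f.IsHomogeneous d} := by
  intro f (hf : f.IsHomogeneous d) g (hg : g.IsHomogeneous d) h
  ext α
  by_cases hα : α.degree = d
  · have hmem : α ∈ Finset.finsuppAntidiag (Finset.univ : Finset (Fin n)) d :=
      Finset.mem_finsuppAntidiag.2 ⟨by rwa [← Finsupp.degree_eq_sum], Finset.subset_univ _⟩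
    have hmult : √(Nat.multinomial Finset.univ α : ℝ) ≠ 0 :=
      (Real.sqrt_pos.2 (Nat.cast_pos.2 (Nat.multinomial_pos _ _))).ne'
    have hcoeff : rescaledCoeff f α = rescaledCoeff g α := congrArg (· ⟨α, hmem⟩) h
    exact (div_left_inj' hmult).1 hcoeff
  · rw [hf.coeff_eq_zero hα, hg.coeff_eq_zero hα]

lemma eq_of_bombieriNorm_le_of_norm_sq_le_inner {g : MvPolynomial (Fin n) ℝ}
    (hf : f.IsHomogeneous d) (hg : g.IsHomogeneous d) (hle : bombieriNorm d f ≤ bombieriNorm d g)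
    (h : bombieriNorm d g ^ 2 ≤ ⟪coeffVector d f, coeffVector d g⟫) : f = g := by
  simp only [← norm_coeffVector] at hle h
  refine injOn_coeffVector n d hf hg (eq_of_norm_le_re_inner_eq_norm_sq (𝕜 := ℝ) hle ?_)
  refine le_antisymm ?_ h
  calc ⟪coeffVector d f, coeffVector d g⟫
      ≤ ‖coeffVector d f‖ * ‖coeffVector d g‖ := real_inner_le_norm _ _
    _ ≤ ‖coeffVector d g‖ ^ 2 := by
      rw [sq]
      gcongr

end Forms

section EuclideanForm

variable {n : ℕ} {m : ℕ} {f : MvPolynomial (Fin n) ℝ}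

lemma isHomogeneous_euclideanForm (m n : ℕ) : (euclideanForm (2 * m) n).IsHomogeneous (2 * m) := by
  rw [euclideanForm, Nat.mul_div_cancel_left _ two_pos]
  exact (MvPolynomial.IsHomogeneous.sum _ _ _ fun i _ ↦ MvPolynomial.isHomogeneous_X_pow i 2).pow m

lemma evalEuclidean_euclideanForm (m : ℕ) (x : EuclideanSpace ℝ (Fin n)) :
    evalEuclidean (euclideanForm (2 * m) n) x = ‖x‖ ^ (2 * m) := by
  simp [evalEuclidean, euclideanForm, pow_mul, EuclideanSpace.real_norm_sq_eq]

lemma euclideanForm_eq_expand (m n : ℕ) :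
    euclideanForm (2 * m) n = MvPolynomial.expand 2 ((∑ i, MvPolynomial.X i) ^ m) := by
  simp [euclideanForm]

lemma coeff_euclideanForm_of_odd {α : Fin n →₀ ℕ} {i : Fin n} (hi : Odd (α i)) :
    MvPolynomial.coeff α (euclideanForm (2 * m) n) = 0 := by
  rw [euclideanForm_eq_expand]
  exact MvPolynomial.coeff_expand_of_not_dvd _ hi.not_two_dvd_nat

lemma coeff_two_nsmul_euclideanForm (β : Fin n →₀ ℕ) :
    MvPolynomial.coeff (2 • β) (euclideanForm (2 * ∑ i, β i) n) =
      Nat.multinomial Finset.univ β := by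
  rw [euclideanForm_eq_expand, MvPolynomial.coeff_expand_smul 2 two_ne_zero,
    MvPolynomial.coeff_sum_X_pow_of_fintype, Finsupp.sum_fintype _ _ fun _ ↦ rfl, if_pos rfl,
    Finsupp.multinomial_eq_of_support_subset (Finset.subset_univ _)]

lemma prod_factorial_two_mul_div {ι : Type*} (s : Finset ι) (β : ι → ℕ) :
    ∏ i ∈ s, ((2 * β i).factorial / (4 ^ β i * (β i).factorial) : ℝ) =
      (2 * ∑ i ∈ s, β i).factorial / (4 ^ (∑ i ∈ s, β i) * (∑ i ∈ s, β i).factorial) *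
        (Nat.multinomial s β / Nat.multinomial s (2 • β)) := by
  have hβ := Nat.multinomial_spec s β
  have hβ2 := Nat.multinomial_spec s (2 • β)
  simp only [Pi.smul_apply, smul_eq_mul, ← Finset.mul_sum] at hβ2
  have hmult : (Nat.multinomial s β : ℝ) ≠ 0 := Nat.cast_ne_zero.2 (Nat.multinomial_pos _ _).ne'
  have hmult2 : (Nat.multinomial s (2 • β) : ℝ) ≠ 0 :=
    Nat.cast_ne_zero.2 (Nat.multinomial_pos _ _).ne'
  rw [Finset.prod_div_distrib, Finset.prod_mul_distrib, Finset.prod_pow_eq_pow_sum, ← hβ, ← hβ2]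
  push_cast
  field_simp

/-- The ratio between the Gaussian integral of a form of degree `2 * m` in `n` variables and its
Bombieri product with the Euclidean form. -/
noncomputable def gaussianFactor (m n : ℕ) : ℝ :=
  √Real.pi ^ n * ((2 * m).factorial / (4 ^ m * m.factorial))

lemma gaussianFactor_pos (m n : ℕ) : 0 < gaussianFactor m n :=
  mul_pos (pow_pos (Real.sqrt_pos.2 Real.pi_pos) n) (by positivity)

lemma prod_integral_pow_mul_exp_neg_sq {α : Fin n →₀ ℕ} (hα : ∑ i, α i = 2 * m) :
    ∏ i, ∫ t : ℝ, t ^ α i * Real.exp (-t ^ 2) = gaussianFactor m n *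
      (MvPolynomial.coeff α (euclideanForm (2 * m) n) / Nat.multinomial Finset.univ α) := by
  by_cases heven : ∀ i, Even (α i)
  · choose β hβ using fun i ↦ (heven i).two_dvd
    obtain rfl : α = 2 • Finsupp.equivFunOnFinite.symm β := Finsupp.ext hβ
    simp only [Finsupp.smul_apply, smul_eq_mul, ← Finset.mul_sum] at hα
    obtain rfl := Nat.eq_of_mul_eq_mul_left two_pos hα.symm
    simp only [Finsupp.smul_apply, smul_eq_mul, integral_pow_two_mul_mul_exp_neg_sq,
      Finset.prod_mul_distrib, prod_factorial_two_mul_div, coeff_two_nsmul_euclideanForm,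
      Finset.prod_const, Finset.card_univ, Fintype.card_fin, gaussianFactor, Finsupp.coe_smul,
      mul_assoc]
  · push Not at heven
    obtain ⟨i, hi⟩ := heven
    rw [Nat.not_even_iff_odd] at hi
    rw [Finset.prod_eq_zero (Finset.mem_univ i) (integral_pow_mul_exp_neg_sq_of_odd hi),
      coeff_euclideanForm_of_odd hi, zero_div, mul_zero]

lemma integral_evalEuclidean_mul_exp_neg_norm_sq (hf : f.IsHomogeneous (2 * m)) :
    ∫ x, evalEuclidean f x * Real.exp (-‖x‖ ^ 2) = gaussianFactor m n *
      ⟪coeffVector (2 * m) f, coeffVector (2 * m) (euclideanForm (2 * m) n)⟫ := by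
  simp only [evalEuclidean_eq_sum hf, Finset.sum_mul, mul_assoc]
  rw [integral_finsetSum _ fun (α : Fin n →₀ ℕ) _ ↦
    (integrable_prod_pow_mul_exp_neg_norm_sq α).const_mul (MvPolynomial.coeff α f),
    inner_coeffVector, Finset.mul_sum]
  refine Finset.sum_congr rfl fun α hα ↦ ?_
  rw [integral_const_mul, integral_prod_pow_mul_exp_neg_norm_sq,
    prod_integral_pow_mul_exp_neg_sq (Finset.mem_finsuppAntidiag.1 hα).1, mul_left_comm]

lemma bombieriNorm_euclideanForm_sq [NeZero n] (m : ℕ) :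
    bombieriNorm (2 * m) (euclideanForm (2 * m) n) ^ 2 =
      ∏ i ∈ Finset.range m, (2 * i + n : ℝ) / (2 * i + 1) := by
  have hn : 0 < (n : ℝ) / 2 := half_pos (Nat.cast_pos.2 (NeZero.pos n))
  have hgauss := integral_evalEuclidean_mul_exp_neg_norm_sq (isHomogeneous_euclideanForm m n)
  simp only [evalEuclidean_euclideanForm] at hgauss
  have harg : ((n : ℝ) + (2 * m : ℕ)) / 2 = n / 2 + m := by
    push_cast
    ring
  rw [integral_norm_pow_mul_exp_neg_norm_sq, Fintype.card_fin, harg, gamma_add_nat hn,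
    mul_div_cancel_left₀ _ (Real.Gamma_pos_of_pos hn).ne', real_inner_self_eq_norm_sq,
    norm_coeffVector, gaussianFactor, ← prod_range_one_half_add, mul_assoc,
    mul_right_inj' (pow_pos (Real.sqrt_pos.2 Real.pi_pos) n).ne'] at hgauss
  have hprod : ∏ i ∈ Finset.range m, (1 / 2 + i : ℝ) ≠ 0 :=
    Finset.prod_ne_zero_iff.2 fun i _ ↦ by positivity
  rw [← mul_right_inj' hprod, ← hgauss, ← Finset.prod_mul_distrib]
  refine Finset.prod_congr rfl fun i _ ↦ ?_
  field_simp
  ring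

lemma bombieriNorm_euclideanForm_pos [NeZero n] (m : ℕ) :
    0 < bombieriNorm (2 * m) (euclideanForm (2 * m) n) := by
  have hn : 0 < n := NeZero.pos n
  refine (sq_pos_iff.1 ?_).lt_of_le' (Real.sqrt_nonneg _)
  rw [bombieriNorm_euclideanForm_sq]
  exact Finset.prod_pos fun i _ ↦ by positivity

lemma isHomogeneous_normalizedEuclideanForm (m n : ℕ) :
    (normalizedEuclideanForm (2 * m) n).IsHomogeneous (2 * m) := by
  rw [normalizedEuclideanForm, MvPolynomial.smul_eq_C_mul]
  exact (isHomogeneous_euclideanForm m n).C_mul _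

lemma bombieriNorm_normalizedEuclideanForm [NeZero n] (m : ℕ) :
    bombieriNorm (2 * m) (normalizedEuclideanForm (2 * m) n) = 1 := by
  have hN := bombieriNorm_euclideanForm_pos (n := n) m
  rw [normalizedEuclideanForm, ← norm_coeffVector, map_smul,
    norm_smul_of_nonneg (inv_nonneg.2 hN.le), norm_coeffVector, inv_mul_cancel₀ hN.ne']

end EuclideanForm

section Minimizer

variable {n : ℕ} {m : ℕ} {f : MvPolynomial (Fin n) ℝ}

/-- The radius of the ball on which the normalized Euclidean form of degree `2 * m` in `n`
variables is at most `1`. -/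
noncomputable def minimalRadius (m n : ℕ) : ℝ :=
  bombieriNorm (2 * m) (euclideanForm (2 * m) n) ^ (((2 * m : ℕ) : ℝ)⁻¹)

lemma minimalRadius_pos [NeZero n] (m : ℕ) : 0 < minimalRadius m n :=
  Real.rpow_pos_of_pos (bombieriNorm_euclideanForm_pos m) _

lemma sublevelSet_normalizedEuclideanForm [NeZero n] (hm : m ≠ 0) :
    sublevelSet (normalizedEuclideanForm (2 * m) n) = Metric.closedBall 0 (minimalRadius m n) := by
  have hN := bombieriNorm_euclideanForm_pos (n := n) m
  have hd : 2 * m ≠ 0 := mul_ne_zero two_ne_zero hm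
  ext x
  rw [mem_closedBall_zero_iff, sublevelSet, mem_ofPred_eq, normalizedEuclideanForm,
    MvPolynomial.smul_eval, ← evalEuclidean, evalEuclidean_euclideanForm, inv_mul_le_iff₀ hN,
    mul_one, ← pow_le_pow_iff_left₀ (norm_nonneg x) (minimalRadius_pos m).le hd, minimalRadius,
    Real.rpow_inv_natCast_pow hN.le hd]

lemma sublevelVolume_normalizedEuclideanForm [NeZero n] (hm : m ≠ 0) :
    sublevelVolume (normalizedEuclideanForm (2 * m) n) =
      ENNReal.ofReal (minimalVolume (2 * m) n) := by
  have hN := bombieriNorm_euclideanForm_pos (n := n) m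
  have hR := minimalRadius_pos (n := n) m
  have hpow : minimalRadius m n ^ n =
      (bombieriNorm (2 * m) (euclideanForm (2 * m) n) ^ 2) ^ ((n : ℝ) / (2 * (2 * m : ℕ))) := by
    rw [minimalRadius, ← Real.rpow_natCast, ← Real.rpow_mul hN.le, ← Real.rpow_natCast _ 2,
      ← Real.rpow_mul hN.le]
    congr 1
    push_cast
    field_simp
  rw [sublevelVolume, sublevelSet_normalizedEuclideanForm hm, EuclideanSpace.volume_closedBall,
    Fintype.card_fin, ← ENNReal.ofReal_pow hR.le, ← ENNReal.ofReal_mul (pow_nonneg hR.le _), hpow,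
    bombieriNorm_euclideanForm_sq, minimalVolume, Nat.mul_div_cancel_left _ two_pos]

lemma bombieriNorm_sq_le_inner_of_integral_le [NeZero n] (hf : f.IsHomogeneous (2 * m))
    (h : ∫ x, evalEuclidean (normalizedEuclideanForm (2 * m) n) x * Real.exp (-‖x‖ ^ 2) ≤
      ∫ x, evalEuclidean f x * Real.exp (-‖x‖ ^ 2)) :
    bombieriNorm (2 * m) (normalizedEuclideanForm (2 * m) n) ^ 2 ≤
      ⟪coeffVector (2 * m) f, coeffVector (2 * m) (normalizedEuclideanForm (2 * m) n)⟫ := by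
  have hN := bombieriNorm_euclideanForm_pos (n := n) m
  rw [integral_evalEuclidean_mul_exp_neg_norm_sq hf,
    integral_evalEuclidean_mul_exp_neg_norm_sq (isHomogeneous_normalizedEuclideanForm m n)] at h
  have hinner := le_of_mul_le_mul_left h (gaussianFactor_pos m n)
  have hsmul (p : MvPolynomial (Fin n) ℝ) :
      ⟪coeffVector (2 * m) p, coeffVector (2 * m) (normalizedEuclideanForm (2 * m) n)⟫ =
        (bombieriNorm (2 * m) (euclideanForm (2 * m) n))⁻¹ *
          ⟪coeffVector (2 * m) p, coeffVector (2 * m) (euclideanForm (2 * m) n)⟫ := by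
    rw [normalizedEuclideanForm, map_smul, real_inner_smul_right]
  rw [← norm_coeffVector, ← real_inner_self_eq_norm_sq, hsmul, hsmul]
  exact mul_le_mul_of_nonneg_left hinner (inv_nonneg.2 hN.le)

lemma eq_normalizedEuclideanForm_of_sublevelVolume_le [NeZero n] (hm : m ≠ 0)
    (hf : f.IsHomogeneous (2 * m)) (hle : bombieriNorm (2 * m) f ≤ 1)
    (hvol : sublevelVolume f ≤ sublevelVolume (normalizedEuclideanForm (2 * m) n)) :
    f = normalizedEuclideanForm (2 * m) n := by
  have hg := isHomogeneous_normalizedEuclideanForm m n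
  have hF := isPosHomogeneous_evalEuclidean hf
  have hG := isPosHomogeneous_evalEuclidean hg
  have hball : {x | evalEuclidean (normalizedEuclideanForm (2 * m) n) x ≤ 1} =
      Metric.closedBall 0 (minimalRadius m n) :=
    sublevelSet_normalizedEuclideanForm hm
  have hsublevel := hF.setIntegral_sublevel_le (mul_ne_zero two_ne_zero hm) hG
    (continuous_evalEuclidean f) (continuous_evalEuclidean _)
    (hball ▸ isCompact_closedBall _ _) hvol
  rw [hball] at hsublevel
  have hgauss := hG.integral_mul_exp_neg_norm_sq_le hF (minimalRadius_pos m) hsublevel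
  rw [← bombieriNorm_normalizedEuclideanForm (n := n) m] at hle
  exact eq_of_bombieriNorm_le_of_norm_sq_le_inner hf hg hle
    (bombieriNorm_sq_le_inner_of_integral_le hf hgauss)

end Minimizer

end BombieriForms

theorem mainTheorem3 (n d : ℕ) (hn : 1 ≤ n) (hd : 2 ≤ d) (hd_even : Even d) :
    (BombieriForms.normalizedEuclideanForm d n).IsHomogeneous d ∧
    BombieriForms.bombieriNorm d (BombieriForms.normalizedEuclideanForm d n) = 1 ∧
    BombieriForms.sublevelVolume (BombieriForms.normalizedEuclideanForm d n) =
      ENNReal.ofReal (BombieriForms.minimalVolume d n) ∧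
    ∀ f : MvPolynomial (Fin n) ℝ, f.IsHomogeneous d → BombieriForms.bombieriNorm d f ≤ 1 →
      ENNReal.ofReal (BombieriForms.minimalVolume d n) ≤ BombieriForms.sublevelVolume f ∧
      (BombieriForms.sublevelVolume f = ENNReal.ofReal (BombieriForms.minimalVolume d n) ↔
        f = BombieriForms.normalizedEuclideanForm d n) := by
  obtain ⟨m, rfl⟩ := hd_even.two_dvd
  have : NeZero n := ⟨by omega⟩
  have hm : m ≠ 0 := by omega
  have hvol := BombieriForms.sublevelVolume_normalizedEuclideanForm (n := n) hm
  refine ⟨BombieriForms.isHomogeneous_normalizedEuclideanForm m n,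
    BombieriForms.bombieriNorm_normalizedEuclideanForm m, hvol, fun f hf hle ↦ ?_⟩
  have hunique := BombieriForms.eq_normalizedEuclideanForm_of_sublevelVolume_le hm hf hle
  rw [← hvol]
  refine ⟨?_, fun heq ↦ hunique heq.le, fun heq ↦ congrArg BombieriForms.sublevelVolume heq⟩
  by_contra! hlt
  exact hlt.ne (congrArg BombieriForms.sublevelVolume (hunique hlt.le))
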